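/- Let $Q$ be a finite quandle with operation $(a,b)\mapsto a*b$, let $A$ be an abelian group written multiplicatively, and let $\phi\in Z^2(Q;A)$ be a quandle 2-cocycle, i.e. a map $\phi:Q\times Q\to A$ with $\phi(x,x)=1$ and $\phi(x,z)\,\phi(x,y)^{-1}\,\phi(x*y,z)^{-1}\,\phi(x*z,y*z)=1$ for all $x,y,z\in Q$. A coloring of an oriented classical link diagram $D$ is a map $\mathcal C$ from the over-arcs of $D$ to $Q$ such that at each crossing $\tau$, if the over-arc has color $y$ and the under-arc away from which the co-orientation normal of the over-arc points has color $x$, then the other under-arc has color $x*y$; the weight is $B(\tau,\mathcal C)=\phi(x,y)^{\epsilon(\tau)}$, where $\epsilon(\tau)=\pm1$ is the sign of $\tau$. Put $\Phi_\phi(D)=\sum_{\mathcal C}\prod_\tau B(\tau,\mathcal C)\in\mathbb Z[A]$, and let $\overline{\sum a_ig_i}=\sum a_ig_i^{-1}$. Oriented links are oriented link diagrams up to planar isotopy and Reidemeister moves; $L^*$ is the mirror image of $L$ and $-L$ is $L$ with the opposite orientation (for a diagram, $D^*$ is its reflection in a line of the plane). Then: 1. $\Phi_\phi(D)$ depends only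 on the oriented link $L$ presented by $D$, so that $\Phi_\phi(L):=\Phi_\phi(D)$ is well defined. 2. For every oriented classical link $L$, $\Phi_\phi(-L^*)=\overline{\Phi_\phi(L)}$. 3. For every diagram $D$ there is a bijection between the colorings of $D$ and those of $-D^*$ under which corresponding arcs, and hence the pairs $(x,y)$ at corresponding crossings, have the same colors, while the signs of corresponding crossings are opposite; thus each weight $\phi(x,y)^{\epsilon}$ becomes $\phi(x,y)^{-\epsilon}$. -/

import Mathlib

open scoped Quandles

/-! ### Quandle 2-cocycles

Mathlib writes the quandle operation as a left action: `y ◃ x` is the element usually written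
`x * y` in knot theory. The coefficient group is written multiplicatively. -/

/-- A quandle 2-cocycle `φ ∈ Z²(X; A)`: the coboundary
`(δφ)(x, y, z) = φ(x, z) φ(x, y)⁻¹ φ(x * y, z)⁻¹ φ(x * z, y * z)` is trivial, and
`φ(x, x) = 1`. -/
structure IsQuandleTwoCocycle {X A : Type*} [Quandle X] [CommGroup A] (φ : X → X → A) :
    Prop where
  coboundary_eq_one : ∀ x y z : X,
    φ x z * (φ x y)⁻¹ * (φ (y ◃ x) z)⁻¹ * φ (z ◃ x) (z ◃ y) = 1
  diag_eq_one : ∀ x : X, φ x x = 1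

/-- The conjugation `∑ aᵢ gᵢ ↦ ∑ aᵢ gᵢ⁻¹` of the group ring `ℤ[A]`. -/
noncomputable def groupRingConj {A : Type*} [CommGroup A] (z : MonoidAlgebra ℤ A) :
    MonoidAlgebra ℤ A :=
  MonoidAlgebra.mapDomain (fun a : A => a⁻¹) z

/-! ### Oriented link diagrams -/

/-- The two strands at a crossing. -/
inductive Level : Type
  | over : Level
  | under : Level

/-- The combinatorial data of an oriented link diagram: a finite set of signed crossings and a
finite set of oriented edges. An oriented strand of level `l` passing through the crossing `c` arrives
along the edge `incoming (c, l)` and leaves along the edge `outgoing (c, l)`. An edge that ends at a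
crossing also starts at a crossing, each in one way; the other edges are simple closed curves
without crossings. -/
structure DiagramCode where
  Crossing : Type
  Edge : Type
  finiteCrossing : Finite Crossing
  finiteEdge : Finite Edge
  sign : Crossing → ℤˣ
  incoming : Crossing × Level → Edge
  outgoing : Crossing × Level → Edge
  incoming_injective : Function.Injective incoming
  outgoing_injective : Function.Injective outgoing
  range_eq : Set.range incoming = Set.range outgoing

namespace DiagramCode

attribute [instance] DiagramCode.finiteCrossing DiagramCode.finiteEdge

variable (D : DiagramCode)

/-- The side of the over-strand at `c` to which the under-strand goes (`true` is the left side,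
`false` the right side). The crossing is positive if (direction of the over-strand, direction of the
under-strand) is a positive frame of the plane, so that the under-strand goes from right to left. -/
def farSide (c : D.Crossing) : Bool :=
  if D.sign c = 1 then true else false

/-- Two sides of edges are adjacent if they bound the same one of the four corners of the plane at
some crossing. `(e, true)` is the left and `(e, false)` the right side of the oriented edge `e`. -/
inductive SideAdj : D.Edge × Bool → D.Edge × Bool → Prop
  | out_out (c : D.Crossing) : SideAdj
      (D.outgoing (c, .over), D.farSide c) (D.outgoing (c, .under), !D.farSide c)
  | out_in (c : D.Crossing) : SideAdj
      (D.outgoing (c, .under), D.farSide c) (D.incoming (c, .over), D.farSide c)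
  | in_in (c : D.Crossing) : SideAdj
      (D.incoming (c, .over), !D.farSide c) (D.incoming (c, .under), D.farSide c)
  | in_out (c : D.Crossing) : SideAdj
      (D.incoming (c, .under), !D.farSide c) (D.outgoing (c, .over), !D.farSide c)

/-- Two edges meet if they have a crossing in common. -/
def EdgeMeets (e e' : D.Edge) : Prop :=
  ∃ c : D.Crossing,
    (∃ l, e = D.incoming (c, l) ∨ e = D.outgoing (c, l)) ∧
    (∃ l, e' = D.incoming (c, l) ∨ e' = D.outgoing (c, l))

/-- The boundary circles of the faces of the surface carrying the diagram. -/
def Face : Type := Quot D.SideAdj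

/-- The connected components of the underlying plane curve. -/
def Piece : Type := Quot D.EdgeMeets

/-- A code is that of a diagram in the plane (equivalently, in the sphere) if each connected piece
has Euler characteristic 2. A piece with `v ≥ 1` crossings has `2 v` edges and a crossingless circle
has two faces, so this means: `#faces = #crossings + 2 #pieces`. -/
def IsPlanar : Prop :=
  Nat.card D.Face = Nat.card D.Crossing + 2 * Nat.card D.Piece

/-! ### Mirror image and reversal -/

/-- The image of the diagram under a reflection of the plane: the crossing signs change. -/
def mirror : DiagramCode where
  Crossing := D.Crossing
  Edge := D.Edge
  finiteCrossing := D.finiteCrossing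
  finiteEdge := D.finiteEdge
  sign c := -D.sign c
  incoming := D.incoming
  outgoing := D.outgoing
  incoming_injective := D.incoming_injective
  outgoing_injective := D.outgoing_injective
  range_eq := D.range_eq

/-- The same diagram with the orientation of every component reversed. -/
def reverse : DiagramCode where
  Crossing := D.Crossing
  Edge := D.Edge
  finiteCrossing := D.finiteCrossing
  finiteEdge := D.finiteEdge
  sign := D.sign
  incoming := D.outgoing
  outgoing := D.incoming
  incoming_injective := D.outgoing_injective
  outgoing_injective := D.incoming_injective
  range_eq := D.range_eq.symm

theorem farSide_mirror (c : D.Crossing) : D.mirror.farSide c = !D.farSide c := by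
  rcases Int.units_eq_one_or (D.sign c) with h | h <;> simp [farSide, mirror, h]

theorem farSide_reverse (c : D.Crossing) : D.reverse.farSide c = D.farSide c := rfl

/-- Exchanging the two sides of every edge. -/
def flipSide {E : Type} (x : E × Bool) : E × Bool := (x.1, !x.2)

theorem sideAdj_mirror {x y : D.Edge × Bool} (h : D.SideAdj x y) :
    D.mirror.SideAdj (flipSide x) (flipSide y) := by
  cases h with
  | out_out c =>
    have := SideAdj.out_out (D := D.mirror) c
    rw [farSide_mirror] at this; exact this
  | out_in c =>
    have := SideAdj.out_in (D := D.mirror) c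
    rw [farSide_mirror] at this; exact this
  | in_in c =>
    have := SideAdj.in_in (D := D.mirror) c
    rw [farSide_mirror] at this; exact this
  | in_out c =>
    have := SideAdj.in_out (D := D.mirror) c
    rw [farSide_mirror] at this; exact this

theorem sideAdj_reverse {x y : D.Edge × Bool} (h : D.SideAdj x y) :
    Quot.mk D.reverse.SideAdj (flipSide x) = Quot.mk D.reverse.SideAdj (flipSide y) := by
  cases h with
  | out_out c =>
    have := SideAdj.in_in (D := D.reverse) c
    simp only [flipSide, Bool.not_not]
    exact Quot.sound this
  | out_in c =>
    have := SideAdj.in_out (D := D.reverse) c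
    simp only [flipSide]
    exact Quot.sound this
  | in_in c =>
    have := SideAdj.out_out (D := D.reverse) c
    simp only [flipSide, Bool.not_not]
    exact Quot.sound this
  | in_out c =>
    have := SideAdj.out_in (D := D.reverse) c
    simp only [flipSide, Bool.not_not]
    exact Quot.sound this

theorem sideAdj_of_mirror {x y : D.mirror.Edge × Bool} (h : D.mirror.SideAdj x y) :
    D.SideAdj (flipSide x : D.Edge × Bool) (flipSide y : D.Edge × Bool) := by
  have key : ∀ c : D.Crossing, (!D.mirror.farSide c) = D.farSide c := fun c => by
    rw [farSide_mirror, Bool.not_not]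
  cases h with
  | out_out c =>
    show D.SideAdj (D.outgoing (c, .over), !D.mirror.farSide c)
      (D.outgoing (c, .under), !!D.mirror.farSide c)
    rw [key c]
    exact SideAdj.out_out (D := D) c
  | out_in c =>
    show D.SideAdj (D.outgoing (c, .under), !D.mirror.farSide c)
      (D.incoming (c, .over), !D.mirror.farSide c)
    rw [key c]
    exact SideAdj.out_in (D := D) c
  | in_in c =>
    show D.SideAdj (D.incoming (c, .over), !!D.mirror.farSide c)
      (D.incoming (c, .under), !D.mirror.farSide c)
    rw [key c]
    exact SideAdj.in_in (D := D) c
  | in_out c =>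
    show D.SideAdj (D.incoming (c, .under), !!D.mirror.farSide c)
      (D.outgoing (c, .over), !!D.mirror.farSide c)
    rw [key c]
    exact SideAdj.in_out (D := D) c

theorem flipSide_flipSide {E : Type} (x : E × Bool) : flipSide (flipSide x) = x := by
  simp [flipSide]

theorem card_face_mirror : Nat.card D.mirror.Face = Nat.card D.Face :=
  Nat.card_congr
    { toFun := Quot.lift (fun x => Quot.mk _ (flipSide x)) fun _ _ h =>
        Quot.sound (D.sideAdj_of_mirror h)
      invFun := Quot.lift (fun x => Quot.mk _ (flipSide x)) fun _ _ h =>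
        Quot.sound (D.sideAdj_mirror h)
      left_inv := by rintro ⟨x⟩; exact congrArg (Quot.mk _) (flipSide_flipSide x)
      right_inv := by rintro ⟨x⟩; exact congrArg (Quot.mk _) (flipSide_flipSide x) }

theorem card_face_reverse : Nat.card D.reverse.Face = Nat.card D.Face := by
  have h : ∀ E : DiagramCode, Nat.card E.Face ≤ Nat.card E.reverse.Face := by
    intro E
    have : Finite E.reverse.Face := Quot.finite _
    let f : E.reverse.Face → E.Face :=
      Quot.lift (fun x => Quot.mk _ (flipSide x)) fun x y hxy => E.reverse.sideAdj_reverse hxy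
    refine Nat.card_le_card_of_surjective f ?_
    rintro ⟨x⟩
    exact ⟨Quot.mk _ (flipSide x), congrArg (Quot.mk _) (flipSide_flipSide x)⟩
  exact le_antisymm (h D.reverse) (h D)

theorem edgeMeets_reverse : D.reverse.EdgeMeets = D.EdgeMeets := by
  funext e e'
  simp only [EdgeMeets, reverse, or_comm]

theorem IsPlanar.mirror {D : DiagramCode} (h : D.IsPlanar) : D.mirror.IsPlanar := by
  unfold IsPlanar at h ⊢
  rw [card_face_mirror]
  exact h

theorem IsPlanar.reverse {D : DiagramCode} (h : D.IsPlanar) : D.reverse.IsPlanar := by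
  unfold IsPlanar at h ⊢
  rw [card_face_reverse, h]
  have : D.reverse.Piece = D.Piece := congrArg Quot D.edgeMeets_reverse
  rw [this]
  rfl

/-! ### Reidemeister moves -/

/-- An isomorphism of codes, that is, a planar isotopy of diagrams. -/
def Isomorphic (D D' : DiagramCode) : Prop :=
  ∃ (g : D.Crossing ≃ D'.Crossing) (f : D.Edge ≃ D'.Edge),
    (∀ c, D'.sign (g c) = D.sign c) ∧
    (∀ c l, D'.incoming (g c, l) = f (D.incoming (c, l))) ∧
    (∀ c l, D'.outgoing (g c, l) = f (D.outgoing (c, l)))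

/-- The two edges of one strand at one of the crossings in `S`. -/
def Through (S : Set D.Crossing) (e e' : D.Edge) : Prop :=
  ∃ c ∈ S, ∃ l, e = D.incoming (c, l) ∧ e' = D.outgoing (c, l)

/-- `D'` is obtained from `D` by deleting the crossings in `S`: at each of them, the incoming and the
outgoing edge of each strand are joined into one edge. -/
def Erases (D : DiagramCode) (S : Set D.Crossing) (D' : DiagramCode) : Prop :=
  ∃ (g : {c : D.Crossing // c ∉ S} ≃ D'.Crossing) (f : Quot (D.Through S) ≃ D'.Edge),
    (∀ c, D'.sign (g c) = D.sign c) ∧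
    (∀ c l, D'.incoming (g c, l) = f (Quot.mk _ (D.incoming (c, l)))) ∧
    (∀ c l, D'.outgoing (g c, l) = f (Quot.mk _ (D.outgoing (c, l))))

/-- Type I: `D'` is `D` with a kink removed. The loop at `c` leaves `c` on one level and returns
to `c` on the other one. -/
def ReidemeisterI (D D' : DiagramCode) : Prop :=
  ∃ c : D.Crossing,
    (D.outgoing (c, .over) = D.incoming (c, .under) ∨
      D.outgoing (c, .under) = D.incoming (c, .over)) ∧
    D.Erases {c} D'

/-- Type II: `D'` is `D` with the two crossings `c`, `d` of a bigon removed. One side of the bigon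
passes over at both crossings, the other side passes under at both, in the same or in the opposite
direction, and the signs of the crossings are opposite. -/
def ReidemeisterII (D D' : DiagramCode) : Prop :=
  ∃ c d : D.Crossing,
    D.sign d = -D.sign c ∧
    D.outgoing (c, .over) = D.incoming (d, .over) ∧
    (D.outgoing (c, .under) = D.incoming (d, .under) ∨
      D.outgoing (d, .under) = D.incoming (c, .under)) ∧
    D.Erases {c, d} D'

/-- An edge joins the passages `p` and `q`, from `p` to `q` if `o = 1` and from `q` to `p`
if `o = -1`. -/
def Joined (o : ℤˣ) (p q : D.Crossing × Level) : Prop :=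
  (o = 1 ∧ D.outgoing p = D.incoming q) ∨ (o = -1 ∧ D.outgoing q = D.incoming p)

open Classical in
/-- Type III: a top, a middle and a bottom strand cross pairwise at `tm`, `tb`, `mb` and bound a
triangle. The numbers `ot`, `om`, `ob` record in which order each strand meets the other two; the
equations between the signs say that the three joining edges bound a triangular face. The move
exchanges, on each of the three strands, the two passages, and changes nothing else. -/
def ReidemeisterIII (D D' : DiagramCode) : Prop :=
  ∃ (tm tb mb : D.Crossing) (ot om ob : ℤˣ)
    (g : D.Crossing ≃ D'.Crossing) (f : D.Edge ≃ D'.Edge),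
    tm ≠ tb ∧ tm ≠ mb ∧ tb ≠ mb ∧
    D.Joined ot (tm, .over) (tb, .over) ∧
    D.Joined om (tm, .under) (mb, .over) ∧
    D.Joined ob (tb, .under) (mb, .under) ∧
    D.sign tm * ot * om = D.sign tb * ot * ob ∧
    D.sign tm * ot * om = D.sign mb * om * ob ∧
    let σ : Equiv.Perm (D.Crossing × Level) :=
      Equiv.swap (tm, .over) (tb, .over) * Equiv.swap (tm, .under) (mb, .over) *
        Equiv.swap (tb, .under) (mb, .under)
    (∀ c, D'.sign (g c) = D.sign c) ∧
    (∀ c l, D'.incoming (g c, l) = f (D.incoming (σ (c, l)))) ∧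
    (∀ c l, D'.outgoing (g c, l) = f (D.outgoing (σ (c, l))))

/-- A planar isotopy or a Reidemeister move. -/
def Move (D D' : DiagramCode) : Prop :=
  D.Isomorphic D' ∨ D.ReidemeisterI D' ∨ D.ReidemeisterII D' ∨ D.ReidemeisterIII D'

theorem Erases.mirror {D D' : DiagramCode} {S : Set D.Crossing} (h : D.Erases S D') :
    D.mirror.Erases S D'.mirror := by
  obtain ⟨g, f, h1, h2, h3⟩ := h
  exact ⟨g, f, fun c => congrArg Neg.neg (h1 c), h2, h3⟩

theorem Move.mirror {D D' : DiagramCode} (h : D.Move D') : D.mirror.Move D'.mirror := by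
  rcases h with ⟨g, f, h1, h2, h3⟩ | ⟨c, hc, h⟩ | ⟨c, d, hs, ho, hu, h⟩ |
    ⟨tm, tb, mb, ot, om, ob, g, f, n1, n2, n3, j1, j2, j3, s1, s2, h1, h2, h3⟩
  · exact .inl ⟨g, f, fun c => congrArg Neg.neg (h1 c), h2, h3⟩
  · exact .inr (.inl ⟨c, hc, h.mirror⟩)
  · exact .inr (.inr (.inl ⟨c, d, congrArg Neg.neg hs, ho, hu, h.mirror⟩))
  · refine .inr (.inr (.inr ⟨tm, tb, mb, ot, om, ob, g, f, n1, n2, n3, j1, j2, j3, ?_, ?_,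
      fun c => congrArg Neg.neg (h1 c), h2, h3⟩))
    · show -D.sign tm * ot * om = -D.sign tb * ot * ob
      simp only [neg_mul, s1]
    · show -D.sign tm * ot * om = -D.sign mb * om * ob
      simp only [neg_mul, s2]

theorem through_reverse (S : Set D.Crossing) {e e' : D.Edge} :
    D.reverse.Through S e e' ↔ D.Through S e' e := by
  constructor <;> rintro ⟨c, hc, l, h1, h2⟩ <;> exact ⟨c, hc, l, h2, h1⟩

/-- Joined edges of a diagram and of its reverse. -/
def quotThroughReverse (S : Set D.Crossing) :
    Quot (D.reverse.Through S) ≃ Quot (D.Through S) where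
  toFun := Quot.lift (Quot.mk _) fun _ _ h => (Quot.sound ((D.through_reverse S).1 h)).symm
  invFun := Quot.lift (Quot.mk _) fun _ _ h => (Quot.sound ((D.through_reverse S).2 h)).symm
  left_inv := by rintro ⟨x⟩; rfl
  right_inv := by rintro ⟨x⟩; rfl

theorem Erases.reverse {D D' : DiagramCode} {S : Set D.Crossing} (h : D.Erases S D') :
    D.reverse.Erases S D'.reverse := by
  obtain ⟨g, f, h1, h2, h3⟩ := h
  exact ⟨g, (D.quotThroughReverse S).trans f, h1, h3, h2⟩

theorem Joined.reverse {D : DiagramCode} {o : ℤˣ} {p q : D.Crossing × Level}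
    (h : D.Joined o p q) : D.reverse.Joined (-o) p q := by
  rcases h with ⟨rfl, h⟩ | ⟨rfl, h⟩
  · exact .inr ⟨rfl, h.symm⟩
  · exact .inl ⟨neg_neg _, h.symm⟩

theorem Move.reverse {D D' : DiagramCode} (h : D.Move D') : D.reverse.Move D'.reverse := by
  rcases h with ⟨g, f, h1, h2, h3⟩ | ⟨c, hc, h⟩ | ⟨c, d, hs, ho, hu, h⟩ |
    ⟨tm, tb, mb, ot, om, ob, g, f, n1, n2, n3, j1, j2, j3, s1, s2, h1, h2, h3⟩
  · exact .inl ⟨g, f, h1, h3, h2⟩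
  · exact .inr (.inl ⟨c, hc.symm.imp Eq.symm Eq.symm, h.reverse⟩)
  · refine .inr (.inr (.inl ⟨d, c, ?_, ho.symm, hu.imp Eq.symm Eq.symm, ?_⟩))
    · show D.sign c = -D.sign d
      rw [hs, neg_neg]
    · exact (Set.pair_comm c d ▸ h).reverse
  · refine .inr (.inr (.inr ⟨tm, tb, mb, -ot, -om, -ob, g, f, n1, n2, n3, j1.reverse, j2.reverse,
      j3.reverse, ?_, ?_, h1, h3, h2⟩))
    · simp only [mul_neg, neg_mul, neg_neg]
      exact s1
    · simp only [mul_neg, neg_mul, neg_neg]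
      exact s2

/-! ### Colorings and the state-sum -/

/-- The two edges of the over-strand at some crossing. -/
def OverAdj (e e' : D.Edge) : Prop :=
  ∃ c : D.Crossing, e = D.incoming (c, .over) ∧ e' = D.outgoing (c, .over)

/-- The over-arcs of the diagram: the curves that remain when the diagram is cut at the
under-passages. -/
def Arc : Type := Quot D.OverAdj

instance : Finite D.Arc := Quot.finite _

/-- The over-arc that contains an edge. -/
def arc (e : D.Edge) : D.Arc := Quot.mk _ e

/-- The over-arc that passes over the crossing. -/
def overArc (c : D.Crossing) : D.Arc := D.arc (D.incoming (c, .over))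

/-- The under-arc on the right of the over-arc, that is, the one away from which the co-orientation
normal of the over-arc points; (tangent, normal) is a positive frame of the plane. -/
def sourceArc (c : D.Crossing) : D.Arc :=
  if D.sign c = 1 then D.arc (D.incoming (c, .under)) else D.arc (D.outgoing (c, .under))

/-- The under-arc on the left of the over-arc, to which the normal of the over-arc points. -/
def targetArc (c : D.Crossing) : D.Arc :=
  if D.sign c = 1 then D.arc (D.outgoing (c, .under)) else D.arc (D.incoming (c, .under))

/-- The colorings of the diagram by the quandle `X`: at each crossing with over-arc colored `y`
and source under-arc colored `x`, the target under-arc is colored `x * y`. -/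
def Coloring (X : Type*) [Quandle X] : Type _ :=
  {C : D.Arc → X // ∀ c, C (D.targetArc c) = C (D.overArc c) ◃ C (D.sourceArc c)}

instance (X : Type*) [Quandle X] [Finite X] : Finite (D.Coloring X) :=
  inferInstanceAs (Finite (Subtype _))

variable {X A : Type*} [Quandle X] [CommGroup A]

/-- The Boltzmann weight `φ(x, y) ^ ε` of a crossing. -/
def weight (φ : X → X → A) (C : D.Coloring X) (c : D.Crossing) : A :=
  φ (C.1 (D.sourceArc c)) (C.1 (D.overArc c)) ^ (D.sign c : ℤ)

/-- The partition function `∑_C ∏_c φ(x, y) ^ ε`, an element of the group ring `ℤ[A]`. -/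
noncomputable def stateSum [Finite X] (φ : X → X → A) : MonoidAlgebra ℤ A :=
  letI := Fintype.ofFinite D.Crossing
  letI := Fintype.ofFinite (D.Coloring X)
  ∑ C : D.Coloring X, MonoidAlgebra.of ℤ A (∏ c : D.Crossing, D.weight φ C c)

end DiagramCode

/-- An oriented classical link diagram (up to planar isotopy). -/
structure LinkDiagram extends DiagramCode where
  planar : toDiagramCode.IsPlanar

namespace LinkDiagram

/-- The diagram `D*`. -/
def mirror (D : LinkDiagram) : LinkDiagram := ⟨D.toDiagramCode.mirror, D.planar.mirror⟩

/-- The diagram `-D`. -/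
def reverse (D : LinkDiagram) : LinkDiagram := ⟨D.toDiagramCode.reverse, D.planar.reverse⟩

/-- Two classical diagrams differ by a planar isotopy or by one Reidemeister move. -/
def Move (D D' : LinkDiagram) : Prop := D.toDiagramCode.Move D'.toDiagramCode

end LinkDiagram

/-- Oriented classical links up to isotopy: the classes of oriented link diagrams under the
equivalence relation generated by planar isotopy and the Reidemeister moves. -/
def OrientedLink : Type 1 := Quot LinkDiagram.Move

/-- The link that a diagram presents. -/
def LinkDiagram.link (D : LinkDiagram) : OrientedLink := Quot.mk _ D

namespace OrientedLink

/-- The mirror image `L*`. -/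
def mirror : OrientedLink → OrientedLink :=
  Quot.map LinkDiagram.mirror fun _ _ h => DiagramCode.Move.mirror h

/-- The link `-L` with the opposite orientation. -/
def reverse : OrientedLink → OrientedLink :=
  Quot.map LinkDiagram.reverse fun _ _ h => DiagramCode.Move.reverse h

/-- The value `Φ_φ(L)` of the partition function on a diagram of `L`. -/
noncomputable def stateSum {X A : Type*} [Quandle X] [Finite X] [CommGroup A] (φ : X → X → A)
    (L : OrientedLink) : MonoidAlgebra ℤ A :=
  (Quot.out L).toDiagramCode.stateSum φ

end OrientedLink

/-! Invariance is local. A coloring of arcs is the same as a coloring of edges that is constant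
along over-passages (`coloringEquiv`), and each Reidemeister move touches only a few edges. For each
move there is a bijection of edge colorings that preserves the product of weights; `stateSum_congr`
turns it into equality of state-sums.

For type I both strands at the kink have one color by idempotence, and the weight is trivial because
`φ x x = 1`. For type II the invertibility of the quandle action determines the color of the hidden
segment, and the two weights cancel. `Erases.stateSum_eq` treats both deletions at once. For type
III self-distributivity (`signAct_distrib`) makes the bottom strand leave the triangle with the same
color in either order of passing, and the cocycle condition (`IsQuandleTwoCocycle.crossWeight_mul`)
makes the weights agree. Measuring crossing signs relative to the direction in which each strand
meets the triangle handles all orientations uniformly.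

For the reversed mirror image, reversal exchanges the incoming and outgoing edges while reflection
negates the sign. Together they preserve source and target, so the same coloring works and each
weight is inverted. -/

/-! ### Quandle algebra at a signed crossing -/

section CrossingAlgebra

variable {X A : Type*} [CommGroup A]

/-- The Boltzmann weight of a crossing of sign `s` in terms of the color `y` of the over-strand and
the colors `p`, `q` of the under-strand before and after the crossing. -/
def crossWeight (φ : X → X → A) (s : ℤˣ) (y p q : X) : A :=
  if s = 1 then φ p y else (φ q y)⁻¹

@[simp] theorem crossWeight_one (φ : X → X → A) (y p q : X) : crossWeight φ 1 y p q = φ p y :=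
  if_pos rfl

@[simp] theorem crossWeight_neg_one (φ : X → X → A) (y p q : X) :
    crossWeight φ (-1) y p q = (φ q y)⁻¹ := if_neg (by decide)

/-- The source color stays the same when the under-strand is followed backwards with the opposite
sign. This gives the cancellation in type II and the change of direction in type III. -/
theorem crossWeight_neg (φ : X → X → A) (s : ℤˣ) (y p q : X) :
    crossWeight φ (-s) y q p = (crossWeight φ s y p q)⁻¹ := by
  rcases Int.units_eq_one_or s with rfl | rfl <;> simp

variable [Quandle X]

/-- The color after passing under a strand colored `y` at a crossing of sign `s`, starting with the
color `p`. -/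
def signAct (s : ℤˣ) (y p : X) : X := if s = 1 then y ◃ p else y ◃⁻¹ p

@[simp] theorem signAct_one (y p : X) : signAct 1 y p = y ◃ p := if_pos rfl

@[simp] theorem signAct_neg_one (y p : X) : signAct (-1) y p = y ◃⁻¹ p := if_neg (by decide)

theorem signAct_self (s : ℤˣ) (y : X) : signAct s y y = y := by
  rcases Int.units_eq_one_or s with rfl | rfl <;> simp

@[simp] theorem signAct_neg_signAct (s : ℤˣ) (y p : X) : signAct (-s) y (signAct s y p) = p := by
  rcases Int.units_eq_one_or s with rfl | rfl <;> simp

@[simp] theorem signAct_signAct_neg (s : ℤˣ) (y p : X) : signAct s y (signAct (-s) y p) = p := by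
  simpa using signAct_neg_signAct (-s) y p

theorem eq_signAct_neg_iff {s : ℤˣ} {y p q : X} : q = signAct (-s) y p ↔ p = signAct s y q := by
  constructor <;> rintro rfl <;> simp

/-- Left translations of a quandle and their inverses are automorphisms, hence respect both `◃` and
`◃⁻¹`. -/
theorem signAct_distrib (a b : ℤˣ) (z m p : X) :
    signAct b (signAct a z m) (signAct a z p) = signAct a z (signAct b m p) := by
  have act_inv (u v w : X) : u ◃ v ◃⁻¹ w = (u ◃ v) ◃⁻¹ (u ◃ w) := by
    rw [← Rack.left_cancel (u ◃ v), ← Shelf.self_distrib, Rack.act_invAct_eq, Rack.act_invAct_eq]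
  have inv_act (u v w : X) : u ◃⁻¹ v ◃ w = (u ◃⁻¹ v) ◃ (u ◃⁻¹ w) := by
    rw [← Rack.left_cancel u, Shelf.self_distrib, Rack.act_invAct_eq, Rack.act_invAct_eq,
      Rack.act_invAct_eq]
  rcases Int.units_eq_one_or a with rfl | rfl <;> rcases Int.units_eq_one_or b with rfl | rfl
  · exact Shelf.self_distrib.symm
  · simp [act_inv]
  · simp [inv_act]
  · simpa using Rack.self_distrib_inv.symm

theorem IsQuandleTwoCocycle.mul_eq {φ : X → X → A} (hφ : IsQuandleTwoCocycle φ) (x y z : X) :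
    φ x z * φ (z ◃ x) (z ◃ y) = φ x y * φ (y ◃ x) z := by
  have h := hφ.coboundary_eq_one x y z
  rw [mul_right_comm, mul_inv_eq_one, mul_right_comm, mul_inv_eq_iff_eq_mul] at h
  rw [h, mul_comm]

/-- The two ways of passing under two crossing strands have the same weight. -/
theorem IsQuandleTwoCocycle.crossWeight_mul {φ : X → X → A} (hφ : IsQuandleTwoCocycle φ)
    (a b : ℤˣ) (z m p : X) :
    crossWeight φ a z p (signAct a z p) *
        crossWeight φ b (signAct a z m) (signAct a z p) (signAct a z (signAct b m p)) =
      crossWeight φ b m p (signAct b m p) *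
        crossWeight φ a z (signAct b m p) (signAct a z (signAct b m p)) := by
  have key := signAct_distrib a b z m p
  -- In each case the cocycle identity is taken at the colors of the bottom and middle strands on
  -- the source side of the strands above them: a negative passage is undone by `◃⁻¹`.
  rcases Int.units_eq_one_or a with rfl | rfl <;> rcases Int.units_eq_one_or b with rfl | rfl
  · simpa using hφ.mul_eq p m z
  · have h := hφ.mul_eq (m ◃⁻¹ p) m z
    simp only [signAct_one, signAct_neg_one, crossWeight_one, crossWeight_neg_one,
      Rack.act_invAct_eq] at h ⊢
    rw [mul_inv_eq_iff_eq_mul, mul_assoc, h, inv_mul_cancel_left]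
  · have h := hφ.mul_eq (z ◃⁻¹ p) (z ◃⁻¹ m) z
    simp only [signAct_one, signAct_neg_one, crossWeight_one, crossWeight_neg_one,
      Rack.act_invAct_eq] at h key ⊢
    rw [key] at h
    rw [inv_mul_eq_iff_eq_mul, ← mul_assoc, h, mul_inv_cancel_right]
  · have h := hφ.mul_eq (z ◃⁻¹ m ◃⁻¹ p) (z ◃⁻¹ m) z
    simp only [signAct_neg_one, crossWeight_neg_one, Rack.act_invAct_eq] at h key ⊢
    rw [← key, Rack.act_invAct_eq, key] at h
    rw [← mul_inv, ← mul_inv, mul_comm, ← h, mul_comm]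

end CrossingAlgebra

namespace DiagramCode

variable {X A : Type*} [Quandle X] [CommGroup A]

/-! ### Colorings of edges -/

/-- The conditions for a map from the edges of the diagram to the quandle to be constant on
over-arcs and to be a coloring. -/
def IsEdgeColoring (D : DiagramCode) (C : D.Edge → X) : Prop :=
  ∀ c, C (D.outgoing (c, .over)) = C (D.incoming (c, .over)) ∧
    C (D.outgoing (c, .under)) =
      signAct (D.sign c) (C (D.incoming (c, .over))) (C (D.incoming (c, .under)))

/-- The weight of a crossing in terms of the colors of the edges. -/
def edgeWeight (D : DiagramCode) (φ : X → X → A) (C : D.Edge → X) (c : D.Crossing) : A :=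
  crossWeight φ (D.sign c) (C (D.incoming (c, .over))) (C (D.incoming (c, .under)))
    (C (D.outgoing (c, .under)))

/-- Colorings of the over-arcs are the same as colorings of the edges. -/
def coloringEquiv (D : DiagramCode) :
    D.Coloring X ≃ {C : D.Edge → X // D.IsEdgeColoring C} where
  toFun C := ⟨fun e => C.1 (D.arc e), fun c => by
    refine ⟨congrArg C.1 (Quot.sound ⟨c, rfl, rfl⟩ :
      D.arc (D.incoming (c, .over)) = D.arc (D.outgoing (c, .over))).symm, ?_⟩
    have h := C.2 c
    rcases Int.units_eq_one_or (D.sign c) with hs | hs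
    · simpa [sourceArc, targetArc, overArc, hs] using h
    -- At a negative crossing the source is the outgoing under-edge, so the coloring rule is read
    -- backwards.
    · rw [hs, eq_signAct_neg_iff]
      simpa [sourceArc, targetArc, overArc, hs] using h⟩
  invFun C := ⟨Quot.lift C.1 (by rintro _ _ ⟨c, rfl, rfl⟩; exact (C.2 c).1.symm), fun c => by
    have h := (C.2 c).2
    rcases Int.units_eq_one_or (D.sign c) with hs | hs
    · simpa [sourceArc, targetArc, overArc, arc, hs] using h
    · rw [hs, eq_signAct_neg_iff] at h
      simpa [sourceArc, targetArc, overArc, arc, hs] using h⟩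
  left_inv C := Subtype.ext (funext (by rintro ⟨e⟩; rfl))
  right_inv C := rfl

theorem weight_eq_edgeWeight (D : DiagramCode) (φ : X → X → A) (C : D.Coloring X)
    (c : D.Crossing) : D.weight φ C c = D.edgeWeight φ (D.coloringEquiv C).1 c := by
  rcases Int.units_eq_one_or (D.sign c) with hs | hs
  · simp only [weight, edgeWeight, sourceArc, overArc, hs, crossWeight_one, if_pos, Units.val_one,
      zpow_one]
    rfl
  · simp only [weight, edgeWeight, sourceArc, overArc, hs, crossWeight_neg_one,
      if_neg (show (-1 : ℤˣ) ≠ 1 by decide), Units.val_neg, Units.val_one, zpow_neg_one]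
    rfl

/-- `finsum` and `finprod` remove the dependence on chosen `Fintype` instances; all index types are
finite, so their default values play no role. -/
theorem stateSum_eq_finsum (D : DiagramCode) [Finite X] (φ : X → X → A) :
    D.stateSum φ = ∑ᶠ C : {C : D.Edge → X // D.IsEdgeColoring C},
      MonoidAlgebra.of ℤ A (∏ᶠ c, D.edgeWeight φ C.1 c) := by
  let := Fintype.ofFinite D.Crossing
  let := Fintype.ofFinite (D.Coloring X)
  rw [← finsum_comp_equiv D.coloringEquiv, finsum_eq_sum_of_fintype]
  simp only [finprod_eq_prod_of_fintype, stateSum, weight_eq_edgeWeight]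

theorem stateSum_congr {D D' : DiagramCode} [Finite X] {φ : X → X → A}
    (F : {C : D.Edge → X // D.IsEdgeColoring C} → {C : D'.Edge → X // D'.IsEdgeColoring C})
    (hF : Function.Bijective F)
    (h : ∀ C, ∏ᶠ c, D'.edgeWeight φ (F C).1 c = ∏ᶠ c, D.edgeWeight φ C.1 c) :
    D.stateSum φ = D'.stateSum φ := by
  rw [stateSum_eq_finsum, stateSum_eq_finsum]
  exact finsum_eq_of_bijective F hF fun C => by rw [h]

/-! ### The reversed mirror image -/

/-- Passing backwards under the same color with the opposite sign is the inverse action, so the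
condition at each crossing is unchanged. -/
theorem isEdgeColoring_mirror_reverse (D : DiagramCode) (C : D.Edge → X) :
    D.mirror.reverse.IsEdgeColoring C ↔ D.IsEdgeColoring C := by
  refine forall_congr' fun c => ?_
  change C (D.incoming (c, .over)) = C (D.outgoing (c, .over)) ∧ C (D.incoming (c, .under)) =
    signAct (-D.sign c) (C (D.outgoing (c, .over))) (C (D.outgoing (c, .under))) ↔ _
  rw [eq_comm, eq_signAct_neg_iff]
  exact and_congr_right fun h => by rw [h]

/-- Colorings of a diagram and of its reversed mirror image: the colors of the edges are the same. -/
def mirrorReverseColoringEquiv (D : DiagramCode) : D.Coloring X ≃ D.mirror.reverse.Coloring X :=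
  D.coloringEquiv.trans ((Equiv.subtypeEquivRight fun C =>
    (D.isEdgeColoring_mirror_reverse C).symm).trans D.mirror.reverse.coloringEquiv.symm)

theorem mirrorReverseColoringEquiv_arc (D : DiagramCode) (C : D.Coloring X) (e : D.Edge) :
    (D.mirrorReverseColoringEquiv C).1 (D.mirror.reverse.arc e) = C.1 (D.arc e) := rfl

/-- After reversal the over-arc is read off at the former outgoing edge, which has the same color.
-/
theorem mirrorReverseColoringEquiv_overArc (D : DiagramCode) (C : D.Coloring X) (c : D.Crossing) :
    (D.mirrorReverseColoringEquiv C).1 (D.mirror.reverse.overArc c) = C.1 (D.overArc c) :=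
  ((D.coloringEquiv C).2 c).1

theorem mirrorReverseColoringEquiv_sourceArc (D : DiagramCode) (C : D.Coloring X)
    (c : D.Crossing) :
    (D.mirrorReverseColoringEquiv C).1 (D.mirror.reverse.sourceArc c) = C.1 (D.sourceArc c) := by
  have hs : D.mirror.reverse.sign c = -D.sign c := rfl
  rcases Int.units_eq_one_or (D.sign c) with h | h
  · simp only [sourceArc]
    rw [if_pos h, if_neg (by rw [hs, h]; decide)]
    rfl
  · simp only [sourceArc]
    rw [if_pos (by rw [hs, h, neg_neg]), if_neg (by rw [h]; decide)]
    rfl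

theorem weight_mirrorReverseColoringEquiv (D : DiagramCode) (φ : X → X → A) (C : D.Coloring X)
    (c : D.Crossing) :
    D.mirror.reverse.weight φ (D.mirrorReverseColoringEquiv C) c = (D.weight φ C c)⁻¹ := by
  simp only [weight, mirrorReverseColoringEquiv_overArc, mirrorReverseColoringEquiv_sourceArc]
  exact zpow_neg _ _

theorem stateSum_mirror_reverse (D : DiagramCode) [Finite X] (φ : X → X → A) :
    D.mirror.reverse.stateSum φ = groupRingConj (D.stateSum φ) := by
  let := Fintype.ofFinite D.Crossing
  let := Fintype.ofFinite (D.Coloring X)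
  let := Fintype.ofFinite (D.mirror.reverse.Coloring X)
  have hconj (s : Finset (D.Coloring X)) (w : D.Coloring X → A) :
      groupRingConj (∑ C ∈ s, MonoidAlgebra.of ℤ A (w C)) =
        ∑ C ∈ s, MonoidAlgebra.of ℤ A (w C)⁻¹ := by
    induction s using Finset.cons_induction with
    | empty => simp [groupRingConj]
    | cons a s ha ih =>
      rw [Finset.sum_cons, Finset.sum_cons, ← ih, groupRingConj, MonoidAlgebra.mapDomain_add]
      simp [groupRingConj]
  rw [stateSum, stateSum, hconj, ← Equiv.sum_comp D.mirrorReverseColoringEquiv]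
  refine Finset.sum_congr rfl fun C _ => congrArg _ ?_
  rw [← Finset.prod_inv_distrib]
  exact Finset.prod_congr rfl fun c _ => D.weight_mirrorReverseColoringEquiv φ C c

/-! ### Planar isotopies and the moves of types I and II -/

theorem stateSum_eq_of_isomorphic {D D' : DiagramCode} [Finite X] (φ : X → X → A)
    (h : D.Isomorphic D') : D.stateSum φ = D'.stateSum φ := by
  obtain ⟨g, f, hs, hi, ho⟩ := h
  have hC (C : D'.Edge → X) : D.IsEdgeColoring (C ∘ f) ↔ D'.IsEdgeColoring C := by
    refine g.forall_congr fun {c} => ?_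
    simp only [hs, hi, ho, Function.comp_apply]
  symm
  refine stateSum_congr (fun C => ⟨C.1 ∘ f, (hC C.1).2 C.2⟩) ⟨fun C₁ C₂ h => ?_, fun C => ?_⟩
    fun C => ?_
  · exact Subtype.ext (f.surjective.injective_comp_right (congrArg Subtype.val h))
  · refine ⟨⟨C.1 ∘ f.symm, (hC _).1 ?_⟩, Subtype.ext ?_⟩
    · simpa [Function.comp_def] using C.2
    · simp [Function.comp_def]
  · rw [← finprod_comp_equiv g]
    simp only [edgeWeight, hs, hi, ho, Function.comp_apply]

/-- Deleting the crossings in `S` does not change the state-sum if, up to a change of the color of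
one edge `m` to that of another edge `n`, the edge colorings are constant along the strands through
`S`, if the old color of `m` can be recovered, and if the crossings in `S` contribute trivially. -/
theorem Erases.stateSum_eq {D D' : DiagramCode} [DecidableEq D.Edge] [Finite X] (φ : X → X → A)
    {S : Set D.Crossing}
    (h : D.Erases S D') {m n : D.Edge} (hnm : n ≠ m)
    (hmn : Quot.mk (D.Through S) m = Quot.mk (D.Through S) n)
    (hm : ∀ c ∉ S, ∀ l, D.incoming (c, l) ≠ m ∧ D.outgoing (c, l) ≠ m)
    (r : (D.Edge → X) → X)
    (hconst : ∀ C : D.Edge → X, D.IsEdgeColoring C → ∀ c ∈ S, ∀ l,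
      Function.update C m (C n) (D.incoming (c, l)) =
        Function.update C m (C n) (D.outgoing (c, l)))
    (hext : ∀ C : D.Edge → X, (∀ c ∈ S, ∀ l, C (D.incoming (c, l)) = C (D.outgoing (c, l))) →
      ∀ c ∈ S,
        Function.update C m (r C) (D.outgoing (c, .over)) =
          Function.update C m (r C) (D.incoming (c, .over)) ∧
        Function.update C m (r C) (D.outgoing (c, .under)) =
          signAct (D.sign c) (Function.update C m (r C) (D.incoming (c, .over)))
            (Function.update C m (r C) (D.incoming (c, .under))))
    (hr : ∀ C : D.Edge → X, D.IsEdgeColoring C → r (Function.update C m (C n)) = C m)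
    (hw : ∀ C : D.Edge → X, D.IsEdgeColoring C → ∏ᶠ c : S, D.edgeWeight φ C c = 1) :
    D.stateSum φ = D'.stateSum φ := by
  obtain ⟨g, f, hs, hi, ho⟩ := h
  -- Once `m` is recolored, the coloring is constant on joined edges and descends to the edges of
  -- `D'`.
  let T (C : {C : D.Edge → X // D.IsEdgeColoring C}) : Quot (D.Through S) → X :=
    Quot.lift (Function.update C.1 m (C.1 n)) (by
      rintro _ _ ⟨c, hc, l, rfl, rfl⟩; exact hconst C.1 C.2 c hc l)
  have hTi (C) (c : {c // c ∉ S}) (l) :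
      T C (Quot.mk _ (D.incoming (c, l))) = C.1 (D.incoming (c, l)) :=
    Function.update_of_ne (hm c c.2 l).1 _ _
  have hTo (C) (c : {c // c ∉ S}) (l) :
      T C (Quot.mk _ (D.outgoing (c, l))) = C.1 (D.outgoing (c, l)) :=
    Function.update_of_ne (hm c c.2 l).2 _ _
  refine stateSum_congr (fun C => ⟨T C ∘ f.symm, ?_⟩) ⟨fun C₁ C₂ h => ?_, fun C => ?_⟩
    fun C => ?_
  · refine g.forall_congr_right.1 fun c => ?_
    simp only [hs, hi, ho, Function.comp_apply, Equiv.symm_apply_apply, hTi, hTo]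
    exact C.2 c
  · have hT : T C₁ = T C₂ :=
      f.symm.surjective.injective_comp_right (congrArg Subtype.val h)
    have hU : Function.update C₁.1 m (C₁.1 n) = Function.update C₂.1 m (C₂.1 n) :=
      funext fun e => congrFun hT (Quot.mk _ e)
    refine Subtype.ext (funext fun e => ?_)
    by_cases he : e = m
    -- The overwritten color at `m` is recovered by `r` from the recolored map alone.
    · rw [he, ← hr _ C₁.2, hU, hr _ C₂.2]
    · simpa [he] using congrFun hU e
  · have hCS : ∀ c ∈ S, ∀ l, C.1 (f (Quot.mk _ (D.incoming (c, l)))) =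
        C.1 (f (Quot.mk _ (D.outgoing (c, l)))) := fun c hc l =>
      congrArg (C.1 ∘ f) (Quot.sound ⟨c, hc, l, rfl, rfl⟩)
    -- The preimage: pull the coloring back to the edges of `D` and insert the color prescribed by
    -- `r` at `m`.
    refine ⟨⟨Function.update (fun e => C.1 (f (Quot.mk _ e))) m
      (r fun e => C.1 (f (Quot.mk _ e))), fun c => ?_⟩, Subtype.ext ?_⟩
    · by_cases hc : c ∈ S
      · exact hext (fun e => C.1 (f (Quot.mk _ e))) hCS c hc
      · have := C.2 (g ⟨c, hc⟩)
        simp only [hs, hi, ho] at this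
        simpa only [Function.update_of_ne (hm c hc _).1, Function.update_of_ne (hm c hc _).2]
    · refine funext (f.surjective.forall.2 (Quot.ind fun e => ?_))
      refine (congrArg (T _) (f.symm_apply_apply _)).trans ?_
      change Function.update (Function.update (fun e => C.1 (f (Quot.mk _ e))) m _) m
        (Function.update (fun e => C.1 (f (Quot.mk _ e))) m _ n) e = _
      rw [Function.update_idem, Function.update_of_ne hnm]
      by_cases he : e = m
      · rw [he, Function.update_self, hmn]
      · rw [Function.update_of_ne he]
  · rw [← finprod_comp_equiv g]
    simp only [edgeWeight, hs, hi, ho, Function.comp_apply, Equiv.symm_apply_apply, hTi, hTo]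
    have hS := hw C.1 C.2
    classical
    let := Fintype.ofFinite D.Crossing
    rw [finprod_eq_prod_of_fintype] at hS
    rw [finprod_eq_prod_of_fintype, finprod_eq_prod_of_fintype,
      ← Fintype.prod_subtype_mul_prod_subtype (· ∈ S)]
    exact (one_mul _).symm.trans (congrArg (· * _) hS.symm)

/-- By idempotence all edges at the kink have the same color, so the weight there is `φ x x` or its
inverse. -/
theorem stateSum_eq_of_reidemeisterI {D D' : DiagramCode} [Finite X] {φ : X → X → A}
    (hφ : IsQuandleTwoCocycle φ) (h : D.ReidemeisterI D') : D.stateSum φ = D'.stateSum φ := by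
  classical
  obtain ⟨c, hc, h⟩ := h
  have hw (C : D.Edge → X) (hC : C (D.incoming (c, .over)) = C (D.incoming (c, .under)) ∨
      C (D.incoming (c, .over)) = C (D.outgoing (c, .under))) (hC' : D.IsEdgeColoring C) :
      ∏ᶠ c : ({c} : Set D.Crossing), D.edgeWeight φ C c = 1 := by
    have h2 := (hC' c).2
    rw [finprod_eq_prod_of_fintype, Fintype.prod_unique]
    change crossWeight φ (D.sign c) (C (D.incoming (c, .over))) (C (D.incoming (c, .under)))
      (C (D.outgoing (c, .under))) = 1
    rcases hC with hC | hC
    · rw [h2, hC, signAct_self]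
      rcases Int.units_eq_one_or (D.sign c) with hs | hs <;> simp [hs, hφ.diag_eq_one]
    · have : C (D.incoming (c, .under)) = C (D.outgoing (c, .under)) := by
        rw [← signAct_neg_signAct (D.sign c) (C (D.incoming (c, .over)))
          (C (D.incoming (c, .under))), ← h2, hC, signAct_self]
      rw [hC, this]
      rcases Int.units_eq_one_or (D.sign c) with hs | hs <;> simp [hs, hφ.diag_eq_one]
  rcases hc with hc | hc
  -- Here `m` is the loop and `n` the edge entering the kink. Injectivity identifies the two ends of
  -- `m`, so `hin` and `hout` decide where an update at `m` is visible.
  · have hin (x) : D.incoming x = D.incoming (c, .under) ↔ x = (c, .under) :=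
      D.incoming_injective.eq_iff
    have hout (x) : D.outgoing x = D.incoming (c, .under) ↔ x = (c, .over) := by
      rw [← hc, D.outgoing_injective.eq_iff]
    have hCo (C : D.Edge → X) (hC : D.IsEdgeColoring C) :
        C (D.incoming (c, .under)) = C (D.incoming (c, .over)) := by rw [← hc, (hC c).1]
    refine h.stateSum_eq φ (m := D.incoming (c, .under)) (n := D.incoming (c, .over))
      (by simp [hin]) (hc ▸ (Quot.sound ⟨c, rfl, .over, rfl, rfl⟩).symm)
      (fun d hd l => by simp_all) (fun C => C (D.incoming (c, .over))) ?_ ?_ ?_ ?_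
    · rintro C hC d hd (_ | _) <;> rw [Set.mem_singleton_iff.1 hd]
      · simp [Function.update_apply, hin, hout]
      · simp [hout, (hC c).2, hCo C hC, signAct_self]
    · intro C hC d hd
      rw [Set.mem_singleton_iff.1 hd]
      have h1 := hC c rfl .over
      have h2 := hC c rfl .under
      simp [hin, hout, signAct_self, ← h2, h1, hc]
    · intro C hC
      simp [hin, hCo C hC]
    · intro C hC
      exact hw C (.inl (hCo C hC).symm) hC
  · have hin (x) : D.incoming x = D.incoming (c, .over) ↔ x = (c, .over) :=
      D.incoming_injective.eq_iff
    have hout (x) : D.outgoing x = D.incoming (c, .over) ↔ x = (c, .under) := by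
      rw [← hc, D.outgoing_injective.eq_iff]
    have hCu (C : D.Edge → X) (hC : D.IsEdgeColoring C) :
        C (D.incoming (c, .under)) = C (D.incoming (c, .over)) := by
      have h2 := (hC c).2
      rw [hc] at h2
      rw [← signAct_neg_signAct (D.sign c) (C (D.incoming (c, .over)))
          (C (D.incoming (c, .under))), ← h2, signAct_self]
    refine h.stateSum_eq φ (m := D.incoming (c, .over)) (n := D.incoming (c, .under))
      (by simp [hin]) (hc ▸ (Quot.sound ⟨c, rfl, .under, rfl, rfl⟩).symm)
      (fun d hd l => by simp_all) (fun C => C (D.incoming (c, .under))) ?_ ?_ ?_ ?_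
    · rintro C hC d hd (_ | _) <;> rw [Set.mem_singleton_iff.1 hd]
      · simp [hout, (hC c).1, hCu C hC]
      · simp [Function.update_apply, hin, hout]
    · intro C hC d hd
      rw [Set.mem_singleton_iff.1 hd]
      have h1 := hC c rfl .over
      have h2 := hC c rfl .under
      simp [hin, hout, signAct_self, h2, ← h1, hc]
    · intro C hC
      simp [hin, hCu C hC]
    · intro C hC
      exact hw C (.inl (hCu C hC).symm) hC

/-- The crossings have the same over-color, opposite signs and exchanged under-colors, so their
weights cancel for an arbitrary `φ`. -/
theorem stateSum_eq_of_reidemeisterII {D D' : DiagramCode} [Finite X] (φ : X → X → A)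
    (h : D.ReidemeisterII D') : D.stateSum φ = D'.stateSum φ := by
  classical
  obtain ⟨c, d, hs, ho, hu, h⟩ := h
  have hcd : c ≠ d := by
    rintro rfl
    rcases Int.units_eq_one_or (D.sign c) with h | h <;> rw [h] at hs <;>
      exact absurd hs (by decide)
  have hdc := hcd.symm
  have hprod (w : D.Crossing → A) :
      ∏ᶠ x : ({c, d} : Set D.Crossing), w x = w c * w d := by
    have := finprod_mem_pair (f := w) hcd
    rwa [← finprod_subtype_eq_finprod_cond] at this
  rcases hu with hu | hu
  -- Parallel strands: `m` is the under-side of the bigon, `n` precedes it, and `r` acts forwards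
  -- through `c`.
  · have hin (x) : D.incoming x = D.incoming (d, .under) ↔ x = (d, .under) :=
      D.incoming_injective.eq_iff
    have hout (x) : D.outgoing x = D.incoming (d, .under) ↔ x = (c, .under) := by
      rw [← hu, D.outgoing_injective.eq_iff]
    have hCu (C : D.Edge → X) (hC : D.IsEdgeColoring C) :
        C (D.incoming (c, .under)) = C (D.outgoing (d, .under)) := by
      have h1 := hC c
      have h2 := hC d
      rw [h2.2, hs, ← ho, ← hu, h1.2, h1.1, signAct_neg_signAct]
    refine h.stateSum_eq φ (m := D.incoming (d, .under)) (n := D.incoming (c, .under))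
      (by simp [hin, hcd]) (hu ▸ (Quot.sound ⟨c, .inl rfl, .under, rfl, rfl⟩).symm)
      (fun e he l => by simp_all) (fun C => signAct (D.sign c) (C (D.incoming (c, .over)))
        (C (D.incoming (c, .under)))) ?_ ?_ ?_ ?_
    · intro C hC
      have h1 := hC c
      have h2 := hC d
      rintro e (he | he) (_ | _) <;> rw [he]
      · simp [hin, hout, h1.1]
      · simp [Function.update_apply, hin, hout, hcd]
      · simp [hin, hout, h2.1]
      · simp [hout, hdc, hCu C hC]
    · intro C hC
      have h1 := hC c (.inl rfl) .over
      have h2 := hC c (.inl rfl) .under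
      have h3 := hC d (.inr rfl) .over
      have h4 := hC d (.inr rfl) .under
      rintro e (he | he) <;> rw [he]
      · simp [Function.update_apply, hin, hout, hcd, h1]
      · simp [hout, hdc, hs, ← h4, ← h3, ← ho, h1, h2, hu]
    · intro C hC
      have h1 := hC c
      have h2 := hC d
      simp [hin, hcd, ← h1.2, hu]
    · intro C hC
      have h1 := hC c
      have h2 := hC d
      rw [hprod, edgeWeight, edgeWeight, hs, ← hu, ← ho, h1.1, ← hCu C hC, crossWeight_neg,
        mul_inv_cancel]
  -- Antiparallel strands: the under-strand meets `d` first, so `n` is taken after `c` and `r` acts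
  -- backwards through `c`.
  · have hin (x) : D.incoming x = D.incoming (c, .under) ↔ x = (c, .under) :=
      D.incoming_injective.eq_iff
    have hout (x) : D.outgoing x = D.incoming (c, .under) ↔ x = (d, .under) := by
      rw [← hu, D.outgoing_injective.eq_iff]
    have hCu (C : D.Edge → X) (hC : D.IsEdgeColoring C) :
        C (D.incoming (d, .under)) = C (D.outgoing (c, .under)) := by
      have h1 := hC c
      have h2 := hC d
      rw [h1.2, ← hu, h2.2, hs, ← ho, h1.1, signAct_signAct_neg]
    refine h.stateSum_eq φ (m := D.incoming (c, .under)) (n := D.outgoing (c, .under))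
      (by simp [hout, hcd]) (Quot.sound ⟨c, .inl rfl, .under, rfl, rfl⟩)
      (fun e he l => by simp_all) (fun C => signAct (-D.sign c) (C (D.incoming (c, .over)))
        (C (D.outgoing (c, .under)))) ?_ ?_ ?_ ?_
    · intro C hC
      have h1 := hC c
      have h2 := hC d
      rintro e (he | he) (_ | _) <;> rw [he]
      · simp [hin, hout, h1.1]
      · simp [hout, hcd]
      · simp [hin, hout, h2.1]
      · simp [Function.update_apply, hin, hout, hdc, hCu C hC]
    · intro C hC
      have h1 := hC c (.inl rfl) .over
      have h2 := hC c (.inl rfl) .under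
      have h3 := hC d (.inr rfl) .over
      have h4 := hC d (.inr rfl) .under
      rintro e (he | he) <;> rw [he]
      · simp [hin, hout, hcd, h1]
      · simp [hin, hout, hcd, hdc, hs, h4, ← h3, ← ho, h1, h2, hu]
    · intro C hC
      have h1 := hC c
      have h2 := hC d
      simp [hin, hout, hcd, h1]
    · intro C hC
      have h1 := hC c
      have h2 := hC d
      rw [hprod, edgeWeight, edgeWeight, hs, hu, ← ho, h1.1, hCu C hC, crossWeight_neg,
        mul_inv_cancel]

end DiagramCode

namespace DiagramCode

variable {X A : Type*} [CommGroup A]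

/-! ### The move of type III -/

/-- The first edge of the passage `p` if its strand is traversed along (`o = 1`) or against
(`o = -1`) its orientation. -/
def edgeBefore (D : DiagramCode) (o : ℤˣ) (p : D.Crossing × Level) : D.Edge :=
  if o = 1 then D.incoming p else D.outgoing p

/-- The second edge of the passage `p` if its strand is traversed along (`o = 1`) or against
(`o = -1`) its orientation. -/
def edgeAfter (D : DiagramCode) (o : ℤˣ) (p : D.Crossing × Level) : D.Edge :=
  if o = 1 then D.outgoing p else D.incoming p

theorem edgeBefore_neg (D : DiagramCode) (o : ℤˣ) (p : D.Crossing × Level) :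
    D.edgeBefore (-o) p = D.edgeAfter o p := by
  rcases Int.units_eq_one_or o with rfl | rfl <;> simp [edgeBefore, edgeAfter]

theorem edgeAfter_neg (D : DiagramCode) (o : ℤˣ) (p : D.Crossing × Level) :
    D.edgeAfter (-o) p = D.edgeBefore o p := by
  rw [← neg_neg o, edgeBefore_neg, neg_neg]

theorem joined_iff {D : DiagramCode} {o : ℤˣ} {p q : D.Crossing × Level} :
    D.Joined o p q ↔ D.edgeAfter o p = D.edgeBefore o q := by
  rcases Int.units_eq_one_or o with rfl | rfl
  · simp [Joined, edgeBefore, edgeAfter]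
  · simp [Joined, edgeBefore, edgeAfter, eq_comm]

/-- The joining edge has a single start and a single end, both already used by `p` and `q`. -/
theorem Joined.edge_ne {D : DiagramCode} {o : ℤˣ} {p q r : D.Crossing × Level}
    (h : D.Joined o p q) (hp : r ≠ p) (hq : r ≠ q) (o' : ℤˣ) :
    D.edgeBefore o' r ≠ D.edgeAfter o p ∧ D.edgeAfter o' r ≠ D.edgeAfter o p := by
  have h1 := D.incoming_injective.ne hp
  have h2 := D.incoming_injective.ne hq
  have h3 := D.outgoing_injective.ne hp
  have h4 := D.outgoing_injective.ne hq
  rcases h with ⟨rfl, h⟩ | ⟨rfl, h⟩ <;> rcases Int.units_eq_one_or o' with rfl | rfl <;>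
    simp_all [edgeBefore, edgeAfter]

theorem Joined.edgeBefore_ne {D : DiagramCode} {o : ℤˣ} {p q : D.Crossing × Level}
    (h : D.Joined o p q) (hpq : p ≠ q) : D.edgeBefore o p ≠ D.edgeAfter o p := by
  have h1 := D.incoming_injective.ne hpq
  have h2 := D.outgoing_injective.ne hpq
  rcases h with ⟨rfl, h⟩ | ⟨rfl, h⟩ <;> simp_all [edgeBefore, edgeAfter]

theorem Joined.edgeAfter_ne {D : DiagramCode} {o : ℤˣ} {p q : D.Crossing × Level}
    (h : D.Joined o p q) (hpq : p ≠ q) : D.edgeAfter o q ≠ D.edgeAfter o p := by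
  have h1 := D.incoming_injective.ne hpq
  have h2 := D.outgoing_injective.ne hpq
  rcases h with ⟨rfl, h⟩ | ⟨rfl, h⟩ <;> simp_all [edgeAfter, eq_comm]

/-- The direction of the under-strand enters only through the relative sign and the exponent `u`;
that of the over-strand does not matter, its color being constant. -/
theorem edgeWeight_eq_zpow (D : DiagramCode) (φ : X → X → A) {C : D.Edge → X} {c : D.Crossing}
    (hC : C (D.outgoing (c, .over)) = C (D.incoming (c, .over))) (o u : ℤˣ) :
    D.edgeWeight φ C c = crossWeight φ (D.sign c * u) (C (D.edgeBefore o (c, .over)))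
      (C (D.edgeBefore u (c, .under))) (C (D.edgeAfter u (c, .under))) ^ (u : ℤ) := by
  have ho : C (D.edgeBefore o (c, .over)) = C (D.incoming (c, .over)) := by
    rcases Int.units_eq_one_or o with rfl | rfl <;> simp [edgeBefore, hC]
  rw [ho]
  rcases Int.units_eq_one_or u with rfl | rfl <;>
    simp [edgeBefore, edgeAfter, edgeWeight, crossWeight_neg]

variable [Quandle X]

/-- The coloring condition at a crossing whose strands are traversed in the directions `o`, `u`. -/
theorem edgeColoring_at_iff (D : DiagramCode) (C : D.Edge → X) (c : D.Crossing) (o u : ℤˣ) :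
    (C (D.outgoing (c, .over)) = C (D.incoming (c, .over)) ∧
      C (D.outgoing (c, .under)) =
        signAct (D.sign c) (C (D.incoming (c, .over))) (C (D.incoming (c, .under)))) ↔
    C (D.edgeAfter o (c, .over)) = C (D.edgeBefore o (c, .over)) ∧
      C (D.edgeAfter u (c, .under)) = signAct (D.sign c * u) (C (D.edgeBefore o (c, .over)))
        (C (D.edgeBefore u (c, .under))) := by
  rcases Int.units_eq_one_or o with rfl | rfl <;> rcases Int.units_eq_one_or u with rfl | rfl
  · simp [edgeBefore, edgeAfter]
  · simp [edgeBefore, edgeAfter, eq_signAct_neg_iff]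
  · simp only [edgeBefore, edgeAfter, if_true, if_neg (show (-1 : ℤˣ) ≠ 1 by decide), mul_one]
    rw [eq_comm]
    exact and_congr_right fun h => by rw [h]
  · simp only [edgeBefore, edgeAfter, if_neg (show (-1 : ℤˣ) ≠ 1 by decide), mul_neg, mul_one,
      eq_signAct_neg_iff]
    rw [eq_comm]
    exact and_congr_right fun h => by rw [h]

/-- The data of a move of type III, in terms of the strands traversed in the directions in which
they meet the crossings in the order of `ReidemeisterIII`. -/
structure TriangleMove (D D' : DiagramCode) (tm tb mb : D.Crossing) (ot om ob a b : ℤˣ)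
    (g : D.Crossing ≃ D'.Crossing) (f : D.Edge ≃ D'.Edge)
    (σ : D.Crossing × Level → D.Crossing × Level) : Prop where
  tm_ne_tb : tm ≠ tb
  tm_ne_mb : tm ≠ mb
  tb_ne_mb : tb ≠ mb
  joined_top : D.Joined ot (tm, .over) (tb, .over)
  joined_middle : D.Joined om (tm, .under) (mb, .over)
  joined_bottom : D.Joined ob (tb, .under) (mb, .under)
  sign_tm : D.sign tm * om = a
  sign_tb : D.sign tb * ob = a
  sign_mb : D.sign mb * ob = b
  perm_tm_over : σ (tm, .over) = (tb, .over)
  perm_tb_over : σ (tb, .over) = (tm, .over)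
  perm_tm_under : σ (tm, .under) = (mb, .over)
  perm_mb_over : σ (mb, .over) = (tm, .under)
  perm_tb_under : σ (tb, .under) = (mb, .under)
  perm_mb_under : σ (mb, .under) = (tb, .under)
  perm_of_ne : ∀ c l, c ≠ tm → c ≠ tb → c ≠ mb → σ (c, l) = (c, l)
  sign_eq : ∀ c, D'.sign (g c) = D.sign c
  incoming_eq : ∀ c l, D'.incoming (g c, l) = f (D.incoming (σ (c, l)))
  outgoing_eq : ∀ c l, D'.outgoing (g c, l) = f (D.outgoing (σ (c, l)))

theorem ReidemeisterIII.exists_triangleMove {D D' : DiagramCode} (h : D.ReidemeisterIII D') :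
    ∃ tm tb mb ot om ob a b g f σ, TriangleMove D D' tm tb mb ot om ob a b g f σ := by
  classical
  obtain ⟨tm, tb, mb, ot, om, ob, g, f, n1, n2, n3, j1, j2, j3, s1, s2, h1, h2, h3⟩ := h
  refine ⟨tm, tb, mb, ot, om, ob, D.sign tm * om, D.sign mb * ob, g, f, _,
    n1, n2, n3, j1, j2, j3, rfl, ?_, rfl, ?_, ?_, ?_, ?_, ?_, ?_, ?_, h1, h2, h3⟩
  -- Cancelling `ot` shows that the middle and the bottom strand pass under the top one with the
  -- same relative sign `a`.
  · rcases Int.units_eq_one_or ot with rfl | rfl <;> simp_all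
  all_goals simp [Equiv.swap_apply_def, n1, n2, n3, n1.symm, n2.symm, n3.symm]
  intro c l h1 h2 h3
  simp [h1, h2, h3]

namespace TriangleMove

variable {D D' : DiagramCode} {tm tb mb : D.Crossing} {ot om ob a b : ℤˣ}
  {g : D.Crossing ≃ D'.Crossing} {f : D.Edge ≃ D'.Edge}
  {σ : D.Crossing × Level → D.Crossing × Level}

theorem edgeBefore_eq (h : TriangleMove D D' tm tb mb ot om ob a b g f σ) (o : ℤˣ)
    (c : D.Crossing) (l : Level) : D'.edgeBefore o (g c, l) = f (D.edgeBefore o (σ (c, l))) := by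
  rw [edgeBefore, edgeBefore, h.incoming_eq, h.outgoing_eq, apply_ite f]

theorem edgeAfter_eq (h : TriangleMove D D' tm tb mb ot om ob a b g f σ) (o : ℤˣ)
    (c : D.Crossing) (l : Level) : D'.edgeAfter o (g c, l) = f (D.edgeAfter o (σ (c, l))) := by
  rw [edgeAfter, edgeAfter, h.incoming_eq, h.outgoing_eq, apply_ite f]

theorem perm_perm (h : TriangleMove D D' tm tb mb ot om ob a b g f σ) (p : D.Crossing × Level) :
    σ (σ p) = p := by
  obtain ⟨c, l⟩ := p
  by_cases h1 : c = tm
  · subst h1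
    cases l <;> simp [h.perm_tm_over, h.perm_tb_over, h.perm_tm_under, h.perm_mb_over]
  by_cases h2 : c = tb
  · subst h2
    cases l <;> simp [h.perm_tm_over, h.perm_tb_over, h.perm_tb_under, h.perm_mb_under]
  by_cases h3 : c = mb
  · subst h3
    cases l <;> simp [h.perm_tm_under, h.perm_mb_over, h.perm_tb_under, h.perm_mb_under]
  rw [h.perm_of_ne c l h1 h2 h3, h.perm_of_ne c l h1 h2 h3]

/-- After the move each strand meets its two crossings in the opposite order; traversing all three
strands backwards restores the original pattern, and `σ` is an involution. -/
theorem symm (h : TriangleMove D D' tm tb mb ot om ob a b g f σ) :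
    TriangleMove D' D (g tm) (g tb) (g mb) (-ot) (-om) (-ob) (-a) (-b) g.symm f.symm
      (fun p => (g (σ (g.symm p.1, p.2)).1, (σ (g.symm p.1, p.2)).2)) where
  tm_ne_tb := g.injective.ne h.tm_ne_tb
  tm_ne_mb := g.injective.ne h.tm_ne_mb
  tb_ne_mb := g.injective.ne h.tb_ne_mb
  joined_top := by
    rw [joined_iff, edgeAfter_neg, edgeBefore_neg, h.edgeBefore_eq, h.edgeAfter_eq,
      h.perm_tm_over, h.perm_tb_over, joined_iff.1 h.joined_top]
  joined_middle := by
    rw [joined_iff, edgeAfter_neg, edgeBefore_neg, h.edgeBefore_eq, h.edgeAfter_eq,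
      h.perm_tm_under, h.perm_mb_over, joined_iff.1 h.joined_middle]
  joined_bottom := by
    rw [joined_iff, edgeAfter_neg, edgeBefore_neg, h.edgeBefore_eq, h.edgeAfter_eq,
      h.perm_tb_under, h.perm_mb_under, joined_iff.1 h.joined_bottom]
  sign_tm := by rw [h.sign_eq, mul_neg, h.sign_tm]
  sign_tb := by rw [h.sign_eq, mul_neg, h.sign_tb]
  sign_mb := by rw [h.sign_eq, mul_neg, h.sign_mb]
  perm_tm_over := by simp [h.perm_tm_over]
  perm_tb_over := by simp [h.perm_tb_over]
  perm_tm_under := by simp [h.perm_tm_under]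
  perm_mb_over := by simp [h.perm_mb_over]
  perm_tb_under := by simp [h.perm_tb_under]
  perm_mb_under := by simp [h.perm_mb_under]
  perm_of_ne c l h1 h2 h3 := by
    simp [h.perm_of_ne _ l (mt g.symm_apply_eq.1 h1) (mt g.symm_apply_eq.1 h2)
      (mt g.symm_apply_eq.1 h3)]
  sign_eq c := by rw [← h.sign_eq, g.apply_symm_apply]
  incoming_eq c l := by
    rw [h.incoming_eq, f.symm_apply_apply]
    exact congrArg D.incoming (h.perm_perm _).symm
  outgoing_eq c l := by
    rw [h.outgoing_eq, f.symm_apply_apply]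
    exact congrArg D.outgoing (h.perm_perm _).symm

/-! ### Transport of colorings across the triangle -/

theorem edgeAfter_ne_edgeAfter (h : TriangleMove D D' tm tb mb ot om ob a b g f σ) :
    D.edgeAfter om (tm, .under) ≠ D.edgeAfter ob (tb, .under) :=
  (h.joined_bottom.edge_ne (by simp [h.tm_ne_tb]) (by simp [h.tm_ne_mb]) om).2

open Classical in
/-- The edge coloring after the move: only the middle segments of the middle and of the bottom
strand get new colors. -/
noncomputable def transport (_ : TriangleMove D D' tm tb mb ot om ob a b g f σ)
    (C : D.Edge → X) : D.Edge → X :=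
  Function.update
    (Function.update C (D.edgeAfter om (tm, .under)) (C (D.edgeBefore om (tm, .under))))
    (D.edgeAfter ob (tb, .under))
    (signAct b (C (D.edgeBefore om (tm, .under))) (C (D.edgeBefore ob (tb, .under))))

section Transport

variable (h : TriangleMove D D' tm tb mb ot om ob a b g f σ) (C : D.Edge → X)

theorem transport_bottom : h.transport C (D.edgeAfter ob (tb, .under)) =
    signAct b (C (D.edgeBefore om (tm, .under))) (C (D.edgeBefore ob (tb, .under))) := by
  classical exact Function.update_self ..

theorem transport_middle : h.transport C (D.edgeAfter om (tm, .under)) =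
    C (D.edgeBefore om (tm, .under)) := by
  classical
  exact (Function.update_of_ne h.edgeAfter_ne_edgeAfter ..).trans (Function.update_self ..)

theorem transport_of_ne {e : D.Edge} (h1 : e ≠ D.edgeAfter om (tm, .under))
    (h2 : e ≠ D.edgeAfter ob (tb, .under)) : h.transport C e = C e := by
  classical exact (Function.update_of_ne h2 ..).trans (Function.update_of_ne h1 ..)

theorem transport_edge {p : D.Crossing × Level} (h1 : p ≠ (tm, .under)) (h2 : p ≠ (mb, .over))
    (h3 : p ≠ (tb, .under)) (h4 : p ≠ (mb, .under)) (o : ℤˣ) :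
    h.transport C (D.edgeBefore o p) = C (D.edgeBefore o p) ∧
      h.transport C (D.edgeAfter o p) = C (D.edgeAfter o p) :=
  have hm := h.joined_middle.edge_ne h1 h2 o
  have hb := h.joined_bottom.edge_ne h3 h4 o
  ⟨h.transport_of_ne C hm.1 hb.1, h.transport_of_ne C hm.2 hb.2⟩

theorem transport_tm_over (o : ℤˣ) :
    h.transport C (D.edgeBefore o (tm, .over)) = C (D.edgeBefore o (tm, .over)) ∧
      h.transport C (D.edgeAfter o (tm, .over)) = C (D.edgeAfter o (tm, .over)) :=
  h.transport_edge C (by simp) (by simp [h.tm_ne_mb]) (by simp) (by simp) o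

theorem transport_tb_over (o : ℤˣ) :
    h.transport C (D.edgeBefore o (tb, .over)) = C (D.edgeBefore o (tb, .over)) ∧
      h.transport C (D.edgeAfter o (tb, .over)) = C (D.edgeAfter o (tb, .over)) :=
  h.transport_edge C (by simp) (by simp [h.tb_ne_mb]) (by simp) (by simp) o

theorem transport_middle_before :
    h.transport C (D.edgeBefore om (tm, .under)) = C (D.edgeBefore om (tm, .under)) :=
  h.transport_of_ne C (h.joined_middle.edgeBefore_ne (by simp))
    (h.joined_bottom.edge_ne (by simp [h.tm_ne_tb]) (by simp [h.tm_ne_mb]) om).1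

theorem transport_middle_after :
    h.transport C (D.edgeAfter om (mb, .over)) = C (D.edgeAfter om (mb, .over)) :=
  h.transport_of_ne C (h.joined_middle.edgeAfter_ne (by simp))
    (h.joined_bottom.edge_ne (by simp) (by simp) om).2

theorem transport_bottom_before :
    h.transport C (D.edgeBefore ob (tb, .under)) = C (D.edgeBefore ob (tb, .under)) :=
  h.transport_of_ne C
    (h.joined_middle.edge_ne (by simp [h.tm_ne_tb.symm]) (by simp) ob).1
    (h.joined_bottom.edgeBefore_ne (by simp [h.tb_ne_mb]))

theorem transport_bottom_after :
    h.transport C (D.edgeAfter ob (mb, .under)) = C (D.edgeAfter ob (mb, .under)) :=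
  h.transport_of_ne C
    (h.joined_middle.edge_ne (by simp [h.tm_ne_mb.symm]) (by simp) ob).2
    (h.joined_bottom.edgeAfter_ne (by simp [h.tb_ne_mb]))

variable {C}

theorem colors_tm
    (h : TriangleMove D D' tm tb mb ot om ob a b g f σ)
    (hC : D.IsEdgeColoring C) :
    C (D.edgeAfter ot (tm, .over)) = C (D.edgeBefore ot (tm, .over)) ∧
      C (D.edgeAfter om (tm, .under)) =
        signAct a (C (D.edgeBefore ot (tm, .over))) (C (D.edgeBefore om (tm, .under))) := by
  rw [← h.sign_tm]
  exact (D.edgeColoring_at_iff C tm ot om).1 (hC tm)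

theorem colors_tb
    (h : TriangleMove D D' tm tb mb ot om ob a b g f σ)
    (hC : D.IsEdgeColoring C) :
    C (D.edgeAfter ot (tb, .over)) = C (D.edgeBefore ot (tm, .over)) ∧
      C (D.edgeAfter ob (tb, .under)) =
        signAct a (C (D.edgeBefore ot (tm, .over))) (C (D.edgeBefore ob (tb, .under))) := by
  rw [← (h.colors_tm hC).1, joined_iff.1 h.joined_top, ← h.sign_tb]
  exact (D.edgeColoring_at_iff C tb ot ob).1 (hC tb)

theorem colors_mb
    (h : TriangleMove D D' tm tb mb ot om ob a b g f σ)
    (hC : D.IsEdgeColoring C) :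
    C (D.edgeAfter om (mb, .over)) = C (D.edgeAfter om (tm, .under)) ∧
      C (D.edgeAfter ob (mb, .under)) =
        signAct b (C (D.edgeAfter om (tm, .under))) (C (D.edgeAfter ob (tb, .under))) := by
  rw [joined_iff.1 h.joined_middle, joined_iff.1 h.joined_bottom, ← h.sign_mb]
  exact (D.edgeColoring_at_iff C mb om ob).1 (hC mb)

/-- The last segment of the bottom strand has the same color in both orders of passing. -/
theorem color_bottom_after
    (h : TriangleMove D D' tm tb mb ot om ob a b g f σ)
    (hC : D.IsEdgeColoring C) :
    C (D.edgeAfter ob (mb, .under)) = signAct a (C (D.edgeBefore ot (tm, .over)))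
      (signAct b (C (D.edgeBefore om (tm, .under))) (C (D.edgeBefore ob (tb, .under)))) := by
  rw [(h.colors_mb hC).2, (h.colors_tm hC).2, (h.colors_tb hC).2, signAct_distrib]

/-- The new colors are chosen so that the rule holds at `mb`. At `tm` it carries over from the old
coloring, and at `tb` it is self-distributivity, through `color_bottom_after`. -/
theorem isEdgeColoring_transport (hC : D.IsEdgeColoring C) :
    D'.IsEdgeColoring (h.transport C ∘ f.symm) := by
  refine g.forall_congr_right.1 fun c => ?_
  by_cases h1 : c = tm
  · subst h1
    rw [D'.edgeColoring_at_iff _ _ ot om]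
    simp only [h.edgeBefore_eq, h.edgeAfter_eq, h.perm_tm_over, h.perm_tm_under,
      Function.comp_apply, f.symm_apply_apply, h.transport_tb_over, h.transport_middle_after,
      ← joined_iff.1 h.joined_middle, ← joined_iff.1 h.joined_top, h.transport_middle, h.sign_eq,
      h.sign_tm, (h.transport_tm_over C _).2]
    rw [(h.colors_tb hC).1, (h.colors_tm hC).1, (h.colors_mb hC).1, (h.colors_tm hC).2]
    exact ⟨rfl, rfl⟩
  by_cases h2 : c = tb
  · subst h2
    rw [D'.edgeColoring_at_iff _ _ ot ob]
    simp only [h.edgeBefore_eq, h.edgeAfter_eq, h.perm_tb_over, h.perm_tb_under,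
      Function.comp_apply, f.symm_apply_apply, h.transport_tm_over, h.transport_bottom_after,
      ← joined_iff.1 h.joined_bottom, h.transport_bottom, h.sign_eq, h.sign_tb]
    exact ⟨(h.colors_tm hC).1, h.color_bottom_after hC⟩
  by_cases h3 : c = mb
  · subst h3
    rw [D'.edgeColoring_at_iff _ _ om ob]
    simp only [h.edgeBefore_eq, h.edgeAfter_eq, h.perm_mb_over, h.perm_mb_under,
      Function.comp_apply, f.symm_apply_apply, h.transport_middle, h.transport_middle_before,
      h.transport_bottom, h.transport_bottom_before, h.sign_eq, h.sign_mb, and_self]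
  have ht (l) := h.transport_edge C (p := (c, l)) (by simp [h1]) (by simp [h3]) (by simp [h2])
    (by simp [h3]) 1
  rw [D'.edgeColoring_at_iff _ _ 1 1]
  simp only [h.edgeBefore_eq, h.edgeAfter_eq, h.perm_of_ne c _ h1 h2 h3, Function.comp_apply,
    f.symm_apply_apply, h.sign_eq, ht]
  exact (D.edgeColoring_at_iff C c 1 1).1 (hC c)

theorem edgeWeight_transport_of_ne {c : D.Crossing} (h1 : c ≠ tm) (h2 : c ≠ tb) (h3 : c ≠ mb)
    (φ : X → X → A) :
    D'.edgeWeight φ (h.transport C ∘ f.symm) (g c) = D.edgeWeight φ C c := by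
  have ht (l) := h.transport_edge C (p := (c, l)) (by simp [h1]) (by simp [h3]) (by simp [h2])
    (by simp [h3]) 1
  simp only [edgeBefore, edgeAfter, if_true] at ht
  simp only [edgeWeight, h.incoming_eq, h.outgoing_eq, h.perm_of_ne c _ h1 h2 h3,
    Function.comp_apply, f.symm_apply_apply, h.sign_eq, ht]

/-- The weight at `tm` is unchanged. Those at `tb` and `mb` lie on the same under-strand, hence
carry the same exponent `ob`, and the signed cocycle identity applies to their product. -/
theorem edgeWeight_transport_mul {φ : X → X → A} (hφ : IsQuandleTwoCocycle φ)
    (hC : D.IsEdgeColoring C) :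
    D'.edgeWeight φ (h.transport C ∘ f.symm) (g tm) *
        (D'.edgeWeight φ (h.transport C ∘ f.symm) (g tb) *
          D'.edgeWeight φ (h.transport C ∘ f.symm) (g mb)) =
      D.edgeWeight φ C tm * (D.edgeWeight φ C tb * D.edgeWeight φ C mb) := by
  have hC' := h.isEdgeColoring_transport hC
  have key := hφ.crossWeight_mul a b (C (D.edgeBefore ot (tm, .over)))
    (C (D.edgeBefore om (tm, .under))) (C (D.edgeBefore ob (tb, .under)))
  rw [D'.edgeWeight_eq_zpow φ (hC' _).1 ot om, D'.edgeWeight_eq_zpow φ (hC' _).1 ot ob,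
    D'.edgeWeight_eq_zpow φ (hC' _).1 om ob, D.edgeWeight_eq_zpow φ (hC _).1 ot om,
    D.edgeWeight_eq_zpow φ (hC _).1 ot ob, D.edgeWeight_eq_zpow φ (hC _).1 om ob]
  simp only [h.edgeBefore_eq, h.edgeAfter_eq, h.perm_tm_over, h.perm_tm_under, h.perm_tb_over,
    h.perm_tb_under, h.perm_mb_over, h.perm_mb_under, Function.comp_apply, f.symm_apply_apply,
    ← joined_iff.1 h.joined_top, ← joined_iff.1 h.joined_middle, ← joined_iff.1 h.joined_bottom,
    h.sign_eq, h.sign_tm, h.sign_tb, h.sign_mb, h.transport_tm_over, h.transport_middle,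
    h.transport_middle_before, h.transport_middle_after, h.transport_bottom,
    h.transport_bottom_before, h.transport_bottom_after, h.color_bottom_after hC,
    (h.colors_tm hC).1, (h.colors_tm hC).2, (h.colors_tb hC).2, (h.colors_mb hC).1]
  rw [← mul_zpow, ← mul_zpow, key, mul_comm (crossWeight φ b _ _ _)]

theorem finprod_edgeWeight_transport {φ : X → X → A} (hφ : IsQuandleTwoCocycle φ)
    (hC : D.IsEdgeColoring C) :
    ∏ᶠ c, D'.edgeWeight φ (h.transport C ∘ f.symm) c = ∏ᶠ c, D.edgeWeight φ C c := by
  classical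
  let := Fintype.ofFinite D.Crossing
  rw [← finprod_comp_equiv g, finprod_eq_prod_of_fintype, finprod_eq_prod_of_fintype,
    ← Finset.prod_mul_prod_compl {tm, tb, mb}, ← Finset.prod_mul_prod_compl {tm, tb, mb}]
  congr 1
  · rw [Finset.prod_insert (by simp [h.tm_ne_tb, h.tm_ne_mb]), Finset.prod_pair h.tb_ne_mb,
      Finset.prod_insert (by simp [h.tm_ne_tb, h.tm_ne_mb]), Finset.prod_pair h.tb_ne_mb]
    exact h.edgeWeight_transport_mul hφ hC
  · refine Finset.prod_congr rfl fun c hc => ?_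
    simp only [Finset.mem_compl, Finset.mem_insert, Finset.mem_singleton, not_or] at hc
    exact h.edgeWeight_transport_of_ne hc.1 hc.2.1 hc.2.2 φ

/-- The two overwritten colors are forced by the coloring rule at `tm` and `tb` from edges that keep
their colors. -/
theorem transport_injOn : Set.InjOn h.transport {C : D.Edge → X | D.IsEdgeColoring C} := by
  intro C hC C' hC' hCC'
  have ht : C (D.edgeBefore ot (tm, .over)) = C' (D.edgeBefore ot (tm, .over)) := by
    rw [← (h.transport_tm_over C _).1, hCC', (h.transport_tm_over C' _).1]
  have hm : C (D.edgeBefore om (tm, .under)) = C' (D.edgeBefore om (tm, .under)) := by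
    rw [← h.transport_middle_before C, hCC', h.transport_middle_before C']
  have hb : C (D.edgeBefore ob (tb, .under)) = C' (D.edgeBefore ob (tb, .under)) := by
    rw [← h.transport_bottom_before C, hCC', h.transport_bottom_before C']
  funext e
  by_cases h1 : e = D.edgeAfter om (tm, .under)
  · rw [h1, (h.colors_tm hC).2, (h.colors_tm hC').2, ht, hm]
  by_cases h2 : e = D.edgeAfter ob (tb, .under)
  · rw [h2, (h.colors_tb hC).2, (h.colors_tb hC').2, ht, hb]
  rw [← h.transport_of_ne C h1 h2, hCC', h.transport_of_ne C' h1 h2]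

/-- The map of edge colorings induced by a move of type III. -/
noncomputable def map :
    {C : D.Edge → X // D.IsEdgeColoring C} → {C : D'.Edge → X // D'.IsEdgeColoring C} :=
  fun C => ⟨h.transport C.1 ∘ f.symm, h.isEdgeColoring_transport C.2⟩

theorem map_injective : Function.Injective (h.map (X := X)) := fun C C' hCC' =>
  Subtype.ext (h.transport_injOn C.2 C'.2
    (f.symm.surjective.injective_comp_right (congrArg Subtype.val hCC')))

/-- The inverse move gives an injection in the other direction; between finite sets, counting
suffices. -/
theorem map_bijective [Finite X] : Function.Bijective (h.map (X := X)) :=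
  (Nat.bijective_iff_injective_and_card _).2 ⟨h.map_injective,
    (Nat.card_le_card_of_injective _ h.map_injective).antisymm
      (Nat.card_le_card_of_injective _ h.symm.map_injective)⟩

end Transport

end TriangleMove

theorem stateSum_eq_of_reidemeisterIII {D D' : DiagramCode} [Finite X] {φ : X → X → A}
    (hφ : IsQuandleTwoCocycle φ) (h : D.ReidemeisterIII D') : D.stateSum φ = D'.stateSum φ := by
  obtain ⟨tm, tb, mb, ot, om, ob, a, b, g, f, σ, h⟩ := h.exists_triangleMove
  exact stateSum_congr h.map h.map_bijective fun C => h.finprod_edgeWeight_transport hφ C.2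

/-! ### Link invariance and the main theorem -/

theorem Move.stateSum_eq {D D' : DiagramCode} [Finite X] {φ : X → X → A}
    (hφ : IsQuandleTwoCocycle φ) (h : D.Move D') : D.stateSum φ = D'.stateSum φ := by
  rcases h with h | h | h | h
  · exact stateSum_eq_of_isomorphic φ h
  · exact stateSum_eq_of_reidemeisterI hφ h
  · exact stateSum_eq_of_reidemeisterII φ h
  · exact stateSum_eq_of_reidemeisterIII hφ h

end DiagramCode

/-- Invariance under moves lets the state-sum descend to the quotient, so the representative picked
by `Quot.out` is immaterial. -/
theorem LinkDiagram.stateSum_link {X A : Type*} [Quandle X] [Finite X] [CommGroup A]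
    {φ : X → X → A} (hφ : IsQuandleTwoCocycle φ) (D : LinkDiagram) :
    D.link.stateSum φ = D.stateSum φ :=
  congrArg (Quot.lift (fun D : LinkDiagram => D.stateSum φ) fun _ _ h =>
    DiagramCode.Move.stateSum_eq hφ h) (Quot.out_eq D.link)

theorem mainTheorem5 {X A : Type*} [Quandle X] [Finite X] [CommGroup A] (φ : X → X → A)
    (hφ : IsQuandleTwoCocycle φ) :
    (∀ D : LinkDiagram, D.link.stateSum φ = D.stateSum φ) ∧
    (∀ L : OrientedLink, L.mirror.reverse.stateSum φ = groupRingConj (L.stateSum φ)) ∧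
    (∀ D : LinkDiagram, ∃ F : D.Coloring X ≃ D.mirror.reverse.Coloring X,
      (∀ (C : D.Coloring X) (e : D.Edge),
        (F C).1 (D.mirror.reverse.arc e) = C.1 (D.arc e)) ∧
      ∀ (C : D.Coloring X) (c : D.Crossing),
        (F C).1 (D.mirror.reverse.sourceArc c) = C.1 (D.sourceArc c) ∧
        (F C).1 (D.mirror.reverse.overArc c) = C.1 (D.overArc c) ∧
        D.mirror.reverse.sign c = -D.sign c ∧
        D.mirror.reverse.weight φ (F C) c = (D.weight φ C c)⁻¹) := by
  refine ⟨LinkDiagram.stateSum_link hφ, ?_, fun D => ?_⟩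
  · rintro ⟨D⟩
    -- Mirror image and reversal of a class are computed by definition on any diagram presenting it.
    change D.mirror.reverse.link.stateSum φ = groupRingConj (D.link.stateSum φ)
    rw [LinkDiagram.stateSum_link hφ, LinkDiagram.stateSum_link hφ]
    exact D.stateSum_mirror_reverse φ
  · exact ⟨D.mirrorReverseColoringEquiv, D.mirrorReverseColoringEquiv_arc, fun C c =>
      ⟨D.mirrorReverseColoringEquiv_sourceArc C c, D.mirrorReverseColoringEquiv_overArc C c, rfl,
        D.weight_mirrorReverseColoringEquiv φ C c⟩⟩
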